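/- A set $U\subseteq\mathbb{R}^n$ is \emph{tropically convex} if for all $x,y\in U$ and all $a,b\in\mathbb{R}$ with $\min(a,b)=0$ the point with coordinates $\min(a+x_i,\,b+y_i)$, $i=1,\dots,n$, lies in $U$. Let $P\subset\mathbb{R}^n$ be a nonempty polyhedron (the solution set of finitely many weak linear inequalities) of dimension $d<n$. A \emph{halfspace} of an affine subspace $L\subseteq\mathbb{R}^n$ is a set $\{x\in L : \langle a,x\rangle\ge c\}$ with $a\in\mathbb{R}^n$, $c\in\mathbb{R}$ and $\langle a,\cdot\rangle$ not constant on $L$. If $L$ is a $d$-dimensional affine subspace containing $P$, then there is exactly one finite set $\mathcal{H}$ of halfspaces of $L$ whose intersection (within $L$; the empty intersection is $L$) is $P$ and from which no member can be omitted without changing the intersection; it is called the (irredundant) $\mathcal{H}$-representation of $P$ in $L$. Then $P$ is tropically convex if and only if $P$ is contained in a tropically convex affine subspace $L\subseteq\mathbb{R}^n$ of dimension $d$ such that every halfspace in the $\mathcal{H}$-representation of $P$ in $L$ is tropically convex (as a subset of $\mathbb{R}^n$). -/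

import Mathlib

/-- A set `U ⊆ ℝⁿ` is tropically convex (min-plus convention) if `(a ⊙ x) ⊕ (b ⊙ y) ∈ U` for all
`x, y ∈ U` and all `a, b ∈ ℝ` with `a ⊕ b = 0`, where `⊕ = min` and `⊙ = +`, coordinatewise. -/
def IsTropicallyConvex {n : ℕ} (U : Set (Fin n → ℝ)) : Prop :=
  ∀ x ∈ U, ∀ y ∈ U, ∀ a b : ℝ, min a b = 0 → (fun i => min (a + x i) (b + y i)) ∈ U

/-- A polyhedron in `ℝⁿ`: the solution set of finitely many weak linear inequalities. -/
def IsPolyhedron {n : ℕ} (P : Set (Fin n → ℝ)) : Prop :=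
  ∃ (m : ℕ) (A : Matrix (Fin m) (Fin n) ℝ) (b : Fin m → ℝ),
    P = {x | ∀ k : Fin m, b k ≤ ∑ i, A k i * x i}

/-- The dimension of a (nonempty) subset of `ℝⁿ`, that is, the dimension of its affine hull. -/
noncomputable def polyDim {n : ℕ} (P : Set (Fin n → ℝ)) : ℕ :=
  Module.finrank ℝ (vectorSpan ℝ P)

/-- `H` is a closed halfspace of the affine subspace `L` of `ℝⁿ`: the part of `L` where
`⟨a, x⟩ ≥ c`, for a linear form `⟨a, ·⟩` that is not constant on `L`. -/
def IsHalfspaceOf {n : ℕ} (L : AffineSubspace ℝ (Fin n → ℝ)) (H : Set (Fin n → ℝ)) : Prop :=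
  ∃ (a : Fin n → ℝ) (c : ℝ), (∃ v ∈ L.direction, ∑ i, a i * v i ≠ 0) ∧
    H = {x | x ∈ L ∧ c ≤ ∑ i, a i * x i}

/-- `ℋ` is an irredundant H-representation of `P` in `L`: a finite set of halfspaces of `L` whose
intersection (within `L`) is `P`, and none of which can be omitted. -/
structure IsHRepresentation {n : ℕ} (L : AffineSubspace ℝ (Fin n → ℝ)) (P : Set (Fin n → ℝ))
    (ℋ : Set (Set (Fin n → ℝ))) : Prop where
  finite : ℋ.Finite
  halfspace : ∀ H ∈ ℋ, IsHalfspaceOf L H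
  inter_eq : (L : Set (Fin n → ℝ)) ∩ ⋂₀ ℋ = P
  irredundant : ∀ H ∈ ℋ, (L : Set (Fin n → ℝ)) ∩ ⋂₀ (ℋ \ {H}) ≠ P

open Filter Topology

section Polyhedra

variable {n : ℕ} {L : AffineSubspace ℝ (Fin n → ℝ)} {P : Set (Fin n → ℝ)}
  {ℋ ℋ' : Set (Set (Fin n → ℝ))}

/-! Near a relative interior point, `P` looks like its affine span; near a relative interior point
of a facet, it looks like that facet's halfspace. Both models are cones with apex the chosen point
`q`. Dilation about `q` by `t > 0` turns a tropical combination with weights `a, b` into one with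
weights `t * a, t * b`, and `min a b = 0` survives the scaling. Hence tropical convexity passes from
`P` to each model (`IsTropicallyConvex.of_isFeasibleDirection`). The converse holds because
intersections of tropically convex sets are tropically convex.

Uniqueness uses the same facet points: the feasible directions of `P` there determine the halfspace,
so every representation contains it. -/

/-- The set of points of `L` at which the linear form `⟨a, ·⟩` is at least `c`. -/
def halfspaceOf (L : AffineSubspace ℝ (Fin n → ℝ)) (a : Fin n → ℝ) (c : ℝ) : Set (Fin n → ℝ) :=
  {x | x ∈ L ∧ c ≤ a ⬝ᵥ x}

/-- `v` is a feasible direction of `S` at `p`: short steps from `p` along `v` stay in `S`. -/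
def IsFeasibleDirection (S : Set (Fin n → ℝ)) (p v : Fin n → ℝ) : Prop :=
  ∀ᶠ t : ℝ in 𝓝[>] 0, p + t • v ∈ S

theorem add_smul_mem_of_mem_direction {p v : Fin n → ℝ} (hp : p ∈ L) (hv : v ∈ L.direction)
    (t : ℝ) : p + t • v ∈ L := by
  have := AffineSubspace.vadd_mem_of_mem_direction (L.direction.smul_mem t hv) hp
  rwa [vadd_eq_add, add_comm] at this

theorem isFeasibleDirection_halfspaceOf_of_lt {a p v : Fin n → ℝ} {c : ℝ} (hp : p ∈ L)
    (hv : v ∈ L.direction) (h : c < a ⬝ᵥ p) : IsFeasibleDirection (halfspaceOf L a c) p v := by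
  have hcont : Tendsto (fun t : ℝ => a ⬝ᵥ p + t * (a ⬝ᵥ v)) (𝓝[>] 0) (𝓝 (a ⬝ᵥ p)) := by
    have : Continuous fun t : ℝ => a ⬝ᵥ p + t * (a ⬝ᵥ v) := by fun_prop
    simpa using (this.tendsto 0).mono_left nhdsWithin_le_nhds
  filter_upwards [hcont.eventually (lt_mem_nhds h)] with t ht
  refine ⟨add_smul_mem_of_mem_direction hp hv t, ?_⟩
  rw [dotProduct_add, dotProduct_smul, smul_eq_mul]
  exact ht.le

theorem isFeasibleDirection_halfspaceOf_of_nonneg {a p v : Fin n → ℝ} {c : ℝ} (hp : p ∈ L)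
    (hv : v ∈ L.direction) (h : c ≤ a ⬝ᵥ p) (hav : 0 ≤ a ⬝ᵥ v) :
    IsFeasibleDirection (halfspaceOf L a c) p v := by
  filter_upwards [self_mem_nhdsWithin] with t ht
  refine ⟨add_smul_mem_of_mem_direction hp hv t, ?_⟩
  rw [dotProduct_add, dotProduct_smul, smul_eq_mul]
  have := mul_nonneg (le_of_lt ht) hav
  linarith

theorem IsFeasibleDirection.inter_sInter {p v : Fin n → ℝ} (hp : p ∈ L) (hv : v ∈ L.direction)
    (hfin : ℋ.Finite) (h : ∀ H ∈ ℋ, IsFeasibleDirection H p v) :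
    IsFeasibleDirection ((L : Set (Fin n → ℝ)) ∩ ⋂₀ ℋ) p v := by
  filter_upwards [(eventually_all_finite hfin).2 h] with t ht
  exact ⟨add_smul_mem_of_mem_direction hp hv t, ht⟩

theorem IsFeasibleDirection.dotProduct_nonneg {a p v : Fin n → ℝ}
    (h : IsFeasibleDirection (halfspaceOf L a (a ⬝ᵥ p)) p v) : 0 ≤ a ⬝ᵥ v := by
  obtain ⟨t, ⟨-, ht⟩, ht0⟩ := (Eventually.and h self_mem_nhdsWithin).exists
  rw [dotProduct_add, dotProduct_smul, smul_eq_mul] at ht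
  have ht0 : 0 < t := ht0
  exact nonneg_of_mul_nonneg_right (by linarith) ht0

theorem IsFeasibleDirection.mono {S T : Set (Fin n → ℝ)} {p v : Fin n → ℝ} (hST : S ⊆ T)
    (h : IsFeasibleDirection S p v) : IsFeasibleDirection T p v :=
  Eventually.mono h fun _ ht => hST ht

theorem IsHalfspaceOf.exists_eq {H : Set (Fin n → ℝ)} (h : IsHalfspaceOf L H) :
    ∃ (a : Fin n → ℝ) (c : ℝ), (∃ v ∈ L.direction, a ⬝ᵥ v ≠ 0) ∧ H = halfspaceOf L a c := h

theorem IsPolyhedron.convex (hP : IsPolyhedron P) : Convex ℝ P := by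
  obtain ⟨m, A, b, rfl⟩ := hP
  intro x hx y hy s t hs ht hst k
  change b k ≤ A k ⬝ᵥ (s • x + t • y)
  have h1 := mul_le_mul_of_nonneg_left (show b k ≤ A k ⬝ᵥ x from hx k) hs
  have h2 := mul_le_mul_of_nonneg_left (show b k ≤ A k ⬝ᵥ y from hy k) ht
  have h3 : s * b k + t * b k = b k := by rw [← add_mul, hst, one_mul]
  rw [dotProduct_add, dotProduct_smul, dotProduct_smul, smul_eq_mul, smul_eq_mul]
  linarith

/-- A linear form that is not constant on the span of `P` and at least `c` on `P` exceeds `c`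
somewhere on `P`. -/
theorem exists_lt_dotProduct_of_vectorSpan {a v : Fin n → ℝ} {c : ℝ}
    (hv : v ∈ vectorSpan ℝ P) (hav : a ⬝ᵥ v ≠ 0) (hc : ∀ p ∈ P, c ≤ a ⬝ᵥ p) :
    ∃ p ∈ P, c < a ⬝ᵥ p := by
  by_contra! hcon
  refine hav ?_
  have heq : ∀ p ∈ P, a ⬝ᵥ p = c := fun p hp => le_antisymm (hcon p hp) (hc p hp)
  clear hav
  rw [vectorSpan_def] at hv
  induction hv using Submodule.span_induction with
  | mem x hx =>
    obtain ⟨p, hp, q, hq, rfl⟩ := hx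
    change a ⬝ᵥ (p - q) = 0
    rw [dotProduct_sub, heq p hp, heq q hq, sub_self]
  | zero => exact dotProduct_zero a
  | add x y _ _ hx hy => rw [dotProduct_add, hx, hy, add_zero]
  | smul r x _ hx => rw [dotProduct_smul, hx, smul_zero]

/-- A midpoint of two points of `P` satisfies strictly every inequality that is strict at either of
them. -/
theorem Convex.exists_forall_lt_dotProduct {ι : Type*} (hP : Convex ℝ P) (hne : P.Nonempty)
    {s : Set ι} (hs : s.Finite) (a : ι → Fin n → ℝ) (c : ι → ℝ)
    (hle : ∀ i ∈ s, ∀ p ∈ P, c i ≤ a i ⬝ᵥ p) (hlt : ∀ i ∈ s, ∃ p ∈ P, c i < a i ⬝ᵥ p) :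
    ∃ p ∈ P, ∀ i ∈ s, c i < a i ⬝ᵥ p := by
  induction s, hs using Set.Finite.induction_on with
  | empty => exact ⟨hne.some, hne.some_mem, by simp⟩
  | @insert i s _ _ ih =>
    obtain ⟨p, hp, hps⟩ := ih (fun j hj => hle j (Or.inr hj)) (fun j hj => hlt j (Or.inr hj))
    obtain ⟨q, hq, hqi⟩ := hlt i (Or.inl rfl)
    refine ⟨(1 / 2 : ℝ) • p + (1 / 2 : ℝ) • q,
      hP hp hq (by norm_num) (by norm_num) (by norm_num), fun j hj => ?_⟩
    rw [dotProduct_add, dotProduct_smul, dotProduct_smul, smul_eq_mul, smul_eq_mul]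
    have h1 := hle j hj p hp
    have h2 := hle j hj q hq
    rcases hj with rfl | hj
    · linarith
    · linarith [hps j hj]

theorem IsHRepresentation.subset_of_mem (h : IsHRepresentation L P ℋ) {H : Set (Fin n → ℝ)}
    (hH : H ∈ ℋ) : P ⊆ H := by
  rw [← h.inter_eq]
  exact fun x hx => hx.2 H hH

theorem IsHRepresentation.subset (h : IsHRepresentation L P ℋ) : P ⊆ L := by
  rw [← h.inter_eq]
  exact Set.inter_subset_left

/-- The affine span of `P` is locally contained in `P` around some point, and each member of an
irredundant representation is so around some boundary point. -/
theorem IsHRepresentation.exists_interior_and_facet_points (h : IsHRepresentation L P ℋ)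
    (hP : Convex ℝ P) (hne : P.Nonempty) (hspan : vectorSpan ℝ P = L.direction) :
    (∃ p ∈ P, ∀ v ∈ L.direction, IsFeasibleDirection P p v) ∧
    ∀ H ∈ ℋ, ∃ (a q : Fin n → ℝ), q ∈ P ∧ (∃ v ∈ L.direction, a ⬝ᵥ v ≠ 0) ∧
      H = halfspaceOf L a (a ⬝ᵥ q) ∧
      ∀ v ∈ L.direction, 0 ≤ a ⬝ᵥ v → IsFeasibleDirection P q v := by
  choose! a c hav hH using fun H hH => (h.halfspace H hH).exists_eq
  have hle : ∀ H ∈ ℋ, ∀ p ∈ P, c H ≤ a H ⬝ᵥ p := fun H hHm p hp => by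
    have := h.subset_of_mem hHm hp
    rw [hH H hHm] at this
    exact this.2
  obtain ⟨p, hp, hplt⟩ := hP.exists_forall_lt_dotProduct hne h.finite a c hle fun H hHm => by
    obtain ⟨v, hv, hv0⟩ := hav H hHm
    exact exists_lt_dotProduct_of_vectorSpan (hspan ▸ hv) hv0 (hle H hHm)
  have hpL := h.subset hp
  refine ⟨⟨p, hp, fun v hv => ?_⟩, fun H hHm => ?_⟩
  · rw [← h.inter_eq]
    refine IsFeasibleDirection.inter_sInter hpL hv h.finite fun H hHm => ?_
    rw [hH H hHm]
    exact isFeasibleDirection_halfspaceOf_of_lt hpL hv (hplt H hHm)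
  -- By irredundancy some `y` violates `H` alone. The segment from `p` to `y` meets the boundary of
  -- `H` at parameter `s < 1`, where all other constraints are still strict.
  obtain ⟨y, ⟨hyL, hyH⟩, hyP⟩ : ∃ y ∈ (L : Set (Fin n → ℝ)) ∩ ⋂₀ (ℋ \ {H}), y ∉ P := by
    by_contra! hcon
    refine h.irredundant H hHm (Set.Subset.antisymm hcon fun x hx => ⟨h.subset hx, fun K hK => ?_⟩)
    exact h.subset_of_mem hK.1 hx
  have hylt : a H ⬝ᵥ y < c H := by
    by_contra! hcon
    refine hyP (h.inter_eq ▸ ⟨hyL, fun K hK => ?_⟩)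
    by_cases hKH : K = H
    · rw [hKH, hH H hHm]
      exact ⟨hyL, hcon⟩
    · exact hyH K ⟨hK, hKH⟩
  have hpH := hplt H hHm
  have hden : 0 < a H ⬝ᵥ p - a H ⬝ᵥ y := by linarith
  set s : ℝ := (a H ⬝ᵥ p - c H) / (a H ⬝ᵥ p - a H ⬝ᵥ y) with hs
  have hs0 : 0 ≤ s := div_nonneg (by linarith) hden.le
  have hs1 : s < 1 := (div_lt_one hden).2 (by linarith)
  have hsmul : s * (a H ⬝ᵥ p - a H ⬝ᵥ y) = a H ⬝ᵥ p - c H := div_mul_cancel₀ _ hden.ne'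
  have hdir : y - p ∈ L.direction := AffineSubspace.vsub_mem_direction hyL hpL
  set q : Fin n → ℝ := p + s • (y - p) with hq
  have hqL : q ∈ L := add_smul_mem_of_mem_direction hpL hdir s
  have hdot : ∀ b : Fin n → ℝ, b ⬝ᵥ q = b ⬝ᵥ p + s * (b ⬝ᵥ y - b ⬝ᵥ p) := fun b => by
    rw [hq, dotProduct_add, dotProduct_smul, dotProduct_sub, smul_eq_mul]
  have hqH : a H ⬝ᵥ q = c H := by
    rw [hdot]
    linarith
  have hqlt : ∀ K ∈ ℋ, K ≠ H → c K < a K ⬝ᵥ q := fun K hK hKH => by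
    have hy : c K ≤ a K ⬝ᵥ y := by
      have := hyH K ⟨hK, hKH⟩
      rw [hH K hK] at this
      exact this.2
    have h1 := mul_pos (sub_pos.2 hs1) (sub_pos.2 (hplt K hK))
    have h2 := mul_nonneg hs0 (sub_nonneg.2 hy)
    rw [hdot]
    linarith
  have hqP : q ∈ P := h.inter_eq ▸ ⟨hqL, fun K hK => by
    rw [hH K hK]
    by_cases hKH : K = H
    · exact ⟨hqL, by rw [hKH, hqH]⟩
    · exact ⟨hqL, (hqlt K hK hKH).le⟩⟩
  refine ⟨a H, q, hqP, hav H hHm, by rw [hqH]; exact hH H hHm, fun v hv hv0 => ?_⟩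
  rw [← h.inter_eq]
  refine IsFeasibleDirection.inter_sInter hqL hv h.finite fun K hK => ?_
  rw [hH K hK]
  by_cases hKH : K = H
  · rw [hKH]
    exact isFeasibleDirection_halfspaceOf_of_nonneg hqL hv hqH.ge hv0
  · exact isFeasibleDirection_halfspaceOf_of_lt hqL hv (hqlt K hK hKH)

theorem IsHRepresentation.subset_of_isHRepresentation (h : IsHRepresentation L P ℋ)
    (h' : IsHRepresentation L P ℋ') (hP : Convex ℝ P) (hne : P.Nonempty)
    (hspan : vectorSpan ℝ P = L.direction) : ℋ ⊆ ℋ' := by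
  intro H hHm
  obtain ⟨a, q, hqP, ⟨w, hw, haw⟩, hH, hfeas⟩ :=
    (h.exists_interior_and_facet_points hP hne hspan).2 H hHm
  have hqL := h.subset hqP
  -- If no member of `ℋ'` had `q` on its boundary, every direction of `L` would be feasible for `P`
  -- at `q`, making `a` vanish on `L.direction`.
  obtain ⟨K, hK, hKq⟩ : ∃ K ∈ ℋ', ∃ b : Fin n → ℝ, (∃ v ∈ L.direction, b ⬝ᵥ v ≠ 0) ∧
      K = halfspaceOf L b (b ⬝ᵥ q) := by
    by_contra! hcon
    have hall : ∀ v ∈ L.direction, 0 ≤ a ⬝ᵥ v := fun v hv => by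
      refine IsFeasibleDirection.dotProduct_nonneg (L := L) (p := q)
        (IsFeasibleDirection.mono (S := P) (hH ▸ h.subset_of_mem hHm) ?_)
      rw [← h'.inter_eq]
      refine IsFeasibleDirection.inter_sInter hqL hv h'.finite fun K hK => ?_
      obtain ⟨b, c, hb, hKeq⟩ := (h'.halfspace K hK).exists_eq
      have hqK := h'.subset_of_mem hK hqP
      rw [hKeq] at hqK
      rw [hKeq]
      refine isFeasibleDirection_halfspaceOf_of_lt hqL hv (lt_of_le_of_ne hqK.2 ?_)
      rintro rfl
      exact hcon K hK b hb hKeq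
    have h1 := hall w hw
    have h2 := hall (-w) (neg_mem hw)
    rw [dotProduct_neg] at h2
    exact haw (by linarith)
  obtain ⟨b, ⟨u, hu, hbu⟩, hKeq⟩ := hKq
  have hpos : ∀ v ∈ L.direction, 0 ≤ a ⬝ᵥ v → 0 ≤ b ⬝ᵥ v := fun v hv hav =>
    IsFeasibleDirection.dotProduct_nonneg (L := L) (p := q)
      ((hfeas v hv hav).mono (hKeq ▸ h'.subset_of_mem hK))
  obtain ⟨u, hu, hbu⟩ : ∃ u ∈ L.direction, b ⬝ᵥ u < 0 := by
    rcases hbu.lt_or_gt with hlt | hgt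
    · exact ⟨u, hu, hlt⟩
    · exact ⟨-u, neg_mem hu, by rw [dotProduct_neg]; linarith⟩
  have hau : a ⬝ᵥ u < 0 := by
    by_contra! hcon
    exact absurd (hpos u hu hcon) (not_le.2 hbu)
  -- The vector `(a ⬝ᵥ v) • u - (a ⬝ᵥ u) • v` and its negative are killed by `a`, so `hpos` forces
  -- `b` to kill them too; the signs then clash.
  have hpos' : ∀ v ∈ L.direction, 0 ≤ b ⬝ᵥ v → 0 ≤ a ⬝ᵥ v := fun v hv hbv => by
    by_contra! hcon
    have := hpos ((a ⬝ᵥ v) • u - (a ⬝ᵥ u) • v)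
      (sub_mem (L.direction.smul_mem _ hu) (L.direction.smul_mem _ hv))
      (by simp only [dotProduct_sub, dotProduct_smul, smul_eq_mul]; linarith)
    have h2 := hpos ((a ⬝ᵥ u) • v - (a ⬝ᵥ v) • u)
      (sub_mem (L.direction.smul_mem _ hv) (L.direction.smul_mem _ hu))
      (by simp only [dotProduct_sub, dotProduct_smul, smul_eq_mul]; linarith)
    simp only [dotProduct_sub, dotProduct_smul, smul_eq_mul] at this h2
    have h3 := mul_pos_of_neg_of_neg hcon hbu
    have h4 := mul_nonpos_of_nonpos_of_nonneg hau.le hbv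
    linarith
  have hHK : H = K := by
    rw [hH, hKeq]
    ext x
    refine and_congr_right fun hx => ?_
    have hd : x - q ∈ L.direction := AffineSubspace.vsub_mem_direction hx hqL
    have h1 := hpos _ hd
    have h2 := hpos' _ hd
    rw [dotProduct_sub, dotProduct_sub, sub_nonneg, sub_nonneg] at h1 h2
    exact ⟨h1, h2⟩
  exact hHK ▸ hK

theorem IsPolyhedron.exists_isHRepresentation (hP : IsPolyhedron P) (hne : P.Nonempty)
    (hPL : P ⊆ L) : ∃ ℋ, IsHRepresentation L P ℋ := by
  obtain ⟨m, A, b, hPeq⟩ := hP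
  have hmem : ∀ x, x ∈ P ↔ ∀ k, b k ≤ A k ⬝ᵥ x := fun x => by rw [hPeq]; rfl
  set 𝒦 : Set (Set (Fin n → ℝ)) :=
    (fun k => halfspaceOf L (A k) (b k)) '' {k | ∃ v ∈ L.direction, A k ⬝ᵥ v ≠ 0} with h𝒦
  have hfin : 𝒦.Finite := (Set.toFinite _).image _
  have h𝒦eq : (L : Set (Fin n → ℝ)) ∩ ⋂₀ 𝒦 = P := by
    refine Set.Subset.antisymm (fun x ⟨hxL, hx⟩ => (hmem x).2 fun k => ?_) fun x hx =>
      ⟨hPL hx, ?_⟩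
    · by_cases hk : ∃ v ∈ L.direction, A k ⬝ᵥ v ≠ 0
      · exact (hx _ ⟨k, hk, rfl⟩).2
      -- A form constant on `L` gives no halfspace; its inequality holds on all of `L` because it
      -- holds at a point of `P`.
      · push Not at hk
        obtain ⟨p, hp⟩ := hne
        have h0 := hk (x - p) (AffineSubspace.vsub_mem_direction hxL (hPL hp))
        rw [dotProduct_sub] at h0
        linarith [(hmem p).1 hp k]
    · rintro _ ⟨k, -, rfl⟩
      exact ⟨hPL hx, (hmem x).1 hx k⟩
  obtain ⟨ℋ, hmin⟩ := Set.Finite.exists_minimal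
    (s := {ℋ | ℋ ⊆ 𝒦 ∧ (L : Set (Fin n → ℝ)) ∩ ⋂₀ ℋ = P})
    (hfin.finite_subsets.subset fun _ h => h.1) ⟨𝒦, subset_rfl, h𝒦eq⟩
  refine ⟨ℋ, hfin.subset hmin.prop.1, fun H hH => ?_, hmin.prop.2, fun H hH heq => ?_⟩
  · obtain ⟨k, hk, rfl⟩ := hmin.prop.1 hH
    exact ⟨A k, b k, hk, rfl⟩
  · have := hmin.le_of_le (y := ℋ \ {H}) ⟨Set.sdiff_subset.trans hmin.prop.1, heq⟩ Set.sdiff_subset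
    exact (this hH).2 rfl

/-- If `P ⊆ S` and every point of `S` is seen from `q` in a feasible direction of `P`, then `S`
inherits tropical convexity from `P`, provided that `S` is closed under dilation from `q`. -/
theorem IsTropicallyConvex.of_isFeasibleDirection {S : Set (Fin n → ℝ)} {q : Fin n → ℝ}
    (hP : IsTropicallyConvex P) (hPS : P ⊆ S)
    (hcone : ∀ v, ∀ t : ℝ, 0 < t → q + t • v ∈ S → q + v ∈ S)
    (hfeas : ∀ x ∈ S, IsFeasibleDirection P q (x - q)) : IsTropicallyConvex S := by
  intro x hx y hy a b hab
  obtain ⟨t, ⟨htx, hty⟩, ht⟩ :=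
    (Eventually.and (Eventually.and (hfeas x hx) (hfeas y hy)) self_mem_nhdsWithin).exists
  have ht : 0 < t := ht
  have hmin := hPS (hP _ htx _ hty (t * a) (t * b)
    (by rw [← mul_min_of_nonneg _ _ ht.le, hab, mul_zero]))
  -- The combination of the two contracted points with weights `t * a`, `t * b` is the contraction
  -- by `t` towards `q` of the combination of `x` and `y`.
  have key := hcone ((fun i => min (a + x i) (b + y i)) - q) t ht (by
    convert hmin using 1
    ext i
    simp only [Pi.add_apply, Pi.smul_apply, Pi.sub_apply, smul_eq_mul]
    rw [← min_sub_sub_right, mul_min_of_nonneg _ _ ht.le, ← min_add_add_left]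
    congr 1 <;> ring)
  rwa [add_sub_cancel] at key

theorem mem_of_add_smul_mem {q v : Fin n → ℝ} {t : ℝ} (hq : q ∈ L) (ht : 0 < t)
    (h : q + t • v ∈ L) : v ∈ L.direction := by
  have := AffineSubspace.vsub_mem_direction h hq
  rw [vsub_eq_sub, add_sub_cancel_left] at this
  exact (L.direction.smul_mem_iff ht.ne').1 this

end Polyhedra

theorem mainTheorem9 (n d : ℕ) (P : Set (Fin n → ℝ)) (hP : IsPolyhedron P) (hne : P.Nonempty)
    (hdim : polyDim P = d) (hd : d < n) :
    (∀ L : AffineSubspace ℝ (Fin n → ℝ), P ⊆ L → Module.finrank ℝ L.direction = d →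
      ∃! ℋ : Set (Set (Fin n → ℝ)), IsHRepresentation L P ℋ) ∧
    (IsTropicallyConvex P ↔
      ∃ L : AffineSubspace ℝ (Fin n → ℝ), P ⊆ L ∧ Module.finrank ℝ L.direction = d ∧
        IsTropicallyConvex (L : Set (Fin n → ℝ)) ∧
        ∃ ℋ : Set (Set (Fin n → ℝ)), IsHRepresentation L P ℋ ∧
          ∀ H ∈ ℋ, IsTropicallyConvex H) := by
  refine ⟨fun L hPL hL => ?_, fun hT => ?_, ?_⟩
  · have hspan : vectorSpan ℝ P = L.direction := by
      refine Submodule.eq_of_le_of_finrank_eq ?_ (hdim.trans hL.symm)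
      rw [← direction_affineSpan]
      exact AffineSubspace.direction_le (affineSpan_le.2 hPL)
    obtain ⟨ℋ, h⟩ := hP.exists_isHRepresentation hne hPL
    exact ⟨ℋ, h, fun ℋ' h' => Set.Subset.antisymm
      (h'.subset_of_isHRepresentation h hP.convex hne hspan)
      (h.subset_of_isHRepresentation h' hP.convex hne hspan)⟩
  · have hPL : P ⊆ affineSpan ℝ P := subset_affineSpan ℝ P
    have hspan : vectorSpan ℝ P = (affineSpan ℝ P).direction := (direction_affineSpan ℝ P).symm
    obtain ⟨ℋ, h⟩ := hP.exists_isHRepresentation hne hPL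
    obtain ⟨⟨p, hp, hpfeas⟩, hfacet⟩ := h.exists_interior_and_facet_points hP.convex hne hspan
    refine ⟨affineSpan ℝ P, hPL, hspan ▸ hdim, ?_, ℋ, h, fun H hH => ?_⟩
    · refine hT.of_isFeasibleDirection (q := p) hPL (fun v t ht hv => ?_) fun x hx =>
        hpfeas _ (AffineSubspace.vsub_mem_direction hx (hPL hp))
      simpa using add_smul_mem_of_mem_direction (hPL hp) (mem_of_add_smul_mem (hPL hp) ht hv) 1
    · obtain ⟨a, q, hq, -, rfl, hfeas⟩ := hfacet H hH
      refine hT.of_isFeasibleDirection (q := q) (h.subset_of_mem hH) (fun v t ht hv => ⟨?_, ?_⟩)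
        fun x hx => hfeas _ (AffineSubspace.vsub_mem_direction hx.1 (hPL hq)) ?_
      · simpa using
          add_smul_mem_of_mem_direction (hPL hq) (mem_of_add_smul_mem (hPL hq) ht hv.1) 1
      · have := hv.2
        rw [dotProduct_add, dotProduct_smul, smul_eq_mul] at this
        have := nonneg_of_mul_nonneg_right (a := t) (b := a ⬝ᵥ v) (by linarith) ht
        rw [dotProduct_add]
        linarith
      · rw [dotProduct_sub, sub_nonneg]
        exact hx.2
  · rintro ⟨L, -, -, hL, ℋ, h, hH⟩
    rw [← h.inter_eq]
    exact fun x hx y hy a b hab => ⟨hL x hx.1 y hy.1 a b hab,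
      fun H hHm => hH H hHm x (hx.2 H hHm) y (hy.2 H hHm) a b hab⟩
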